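/- Let $G$ be an infinite finitely generated group, and let $G\wr\mathbb Z$ be the group of all pairs $(f,x)$, where $x\in\mathbb Z$ and $f:\mathbb Z\to G$ satisfies $f(z)=e_G$ for all but finitely many $z$, with the product $(f,x)(g,y)=(z\mapsto f(z)g(z-x),\,x+y)$. For an infinite group $\Gamma$ with a finite symmetric generating set $S$, let $d_\Gamma$ be the left-invariant word metric induced by $S$, and let the Hilbert compression exponent $\alpha^*(\Gamma)$ be the supremum of all $\alpha\ge 0$ for which there exist a Lipschitz map $f:\Gamma\to L_2$ and $c>0$ such that $\|f(x)-f(y)\|_2\ge c\,d_\Gamma(x,y)^\alpha$ for all distinct $x,y\in \Gamma$. Then, for every choice of finite symmetric generating sets of $G$ and of $G\wr\mathbb Z$, $$\alpha^*(G)\ge \tfrac12\implies \alpha^*(G\wr\mathbb Z)\ge\frac{2\alpha^*(G)}{2\alpha^*(G)+1},$$ and $$\alpha^*(G)\le \tfrac12\implies \alpha^*(G\wr\mathbb Z)=\alpha^*(G).$$ -/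

import Mathlib

open MeasureTheory

noncomputable section

namespace Compression

/-- `S` is a finite symmetric generating set of the group `G`. -/
structure IsFiniteSymmGen {G : Type*} [Group G] (S : Set G) : Prop where
  finite : S.Finite
  symm : ∀ s, s ∈ S ↔ s⁻¹ ∈ S
  closure_eq_top : Subgroup.closure S = ⊤

/-- The word length of `g`: the least length of a word in the letters `S` that represents `g`. -/
def wordLength {G : Type*} [Group G] (S : Set G) (g : G) : ℕ :=
  sInf {n | ∃ l : List G, (∀ s ∈ l, s ∈ S) ∧ l.prod = g ∧ l.length = n}

/-- The left-invariant word metric `d_G(x, y)` induced by `S`. -/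
def wordDist {G : Type*} [Group G] (S : Set G) (x y : G) : ℕ :=
  wordLength S (x⁻¹ * y)

/-- There is a Lipschitz map `f : G → X` with `‖f x - f y‖ ≥ c * d_G(x, y) ^ α` for some `c > 0`.
The lower bound is asked for `x ≠ y`; for `x = y` it is empty when `α > 0`, and this keeps the
convention `0 ^ 0 = 1` from playing a role when `α = 0`. -/
def HasCompression {G : Type*} [Group G] (S : Set G) (X : Type*) [NormedAddCommGroup X]
    (α : ℝ) : Prop :=
  ∃ f : G → X,
    (∃ L : ℝ, ∀ x y, ‖f x - f y‖ ≤ L * (wordDist S x y : ℝ)) ∧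
    ∃ c : ℝ, 0 < c ∧ ∀ x y, x ≠ y → c * (wordDist S x y : ℝ) ^ α ≤ ‖f x - f y‖

/-- The compression exponent `α*_X(G)`, with `G` metrized by the generating set `S`. For an infinite
group with a finite generating set, every admissible exponent is at most `1`, so that this is a
supremum of a bounded set. -/
def compressionExponent {G : Type*} [Group G] (S : Set G) (X : Type*)
    [NormedAddCommGroup X] : ℝ :=
  sSup {α : ℝ | 0 ≤ α ∧ HasCompression S X α}

/-- The Hilbert space `L₂ = L₂([0, 1])`. -/
abbrev L2 : Type := Lp ℝ 2 ((volume : Measure ℝ).restrict (Set.Icc 0 1))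

/-- The Hilbert compression exponent `α*(G)`, with `G` metrized by the generating set `S`. -/
def hilbertCompressionExponent {G : Type*} [Group G] (S : Set G) : ℝ :=
  compressionExponent S L2

/-- The (restricted) wreath product of `G` and `H`: the group of all pairs `(f, x)` with
`f : H → G` of finite support and `x : H`, with the product
`(f, x) (g, y) = (z ↦ f z * g (x⁻¹ * z), x * y)`, realized inside Mathlib's unrestricted regular
wreath product, which has the same multiplication. -/
def wreath (G H : Type*) [Group G] [Group H] : Subgroup (RegularWreathProduct G H) where
  carrier := {w | (Function.mulSupport w.left).Finite}
  one_mem' := by simp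
  mul_mem' := by
    intro a b ha hb
    simp only [Set.mem_setOf_eq, RegularWreathProduct.mul_left] at ha hb ⊢
    refine (ha.union (hb.preimage ((mul_right_injective a.right⁻¹).injOn))).subset ?_
    exact Function.mulSupport_mul _ _
  inv_mem' := by
    intro a ha
    simp only [Set.mem_setOf_eq, RegularWreathProduct.inv_left] at ha ⊢
    refine (ha.preimage ((mul_right_injective a.right).injOn)).subset ?_
    intro z hz
    simpa using hz

/-- The element `(e, x)` of the wreath product. -/
def shift (G : Type*) {H : Type*} [Group G] [Group H] (x : H) : wreath G H :=
  ⟨⟨1, x⟩, by simp [wreath]⟩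

open Classical in
/-- The element `(δ_g, e)` of the wreath product. -/
def lamp {G : Type*} (H : Type*) [Group G] [Group H] (g : G) : wreath G H :=
  ⟨⟨Pi.mulSingle 1 g, 1⟩, (Set.finite_singleton (1 : H)).subset (Pi.mulSupport_mulSingle_subset)⟩

/-- The canonical generating set of the wreath product. -/
def canonicalGens {G H : Type*} [Group G] [Group H] (S : Set G) (T : Set H) : Set (wreath G H) :=
  shift G '' T ∪ lamp H '' S

theorem shift_one {G H : Type*} [Group G] [Group H] : shift G (1 : H) = 1 := rfl

theorem shift_mul {G H : Type*} [Group G] [Group H] (x y : H) :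
    shift G (x * y) = shift G x * shift G y := by
  apply Subtype.ext
  ext z
  · simp [shift]
  · rfl

theorem lamp_one {G H : Type*} [Group G] [Group H] : lamp H (1 : G) = 1 := by
  apply Subtype.ext
  ext z
  · simp [lamp]
  · rfl

theorem lamp_mul {G H : Type*} [Group G] [Group H] (x y : G) :
    lamp H (x * y) = lamp H x * lamp H y := by
  apply Subtype.ext
  ext z
  · by_cases h : z = 1 <;> simp [lamp, Pi.mulSingle_apply, h]
  · simp [lamp]

theorem shift_inv {G H : Type*} [Group G] [Group H] (x : H) :
    shift G x⁻¹ = (shift G x)⁻¹ := by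
  rw [eq_inv_iff_mul_eq_one, ← shift_mul, inv_mul_cancel, shift_one]

theorem lamp_inv {G H : Type*} [Group G] [Group H] (x : G) :
    lamp H x⁻¹ = (lamp H x)⁻¹ := by
  rw [eq_inv_iff_mul_eq_one, ← lamp_mul, inv_mul_cancel, lamp_one]

/-- The canonical generating set is a finite symmetric generating set of the wreath product. -/
theorem isFiniteSymmGen_canonicalGens {G H : Type*} [Group G] [Group H] {S : Set G} {T : Set H}
    (hS : IsFiniteSymmGen S) (hT : IsFiniteSymmGen T) :
    IsFiniteSymmGen (canonicalGens S T) := by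
  classical
  have hinv : ∀ w, w ∈ canonicalGens S T → w⁻¹ ∈ canonicalGens S T := by
    rintro w (⟨t, ht, rfl⟩ | ⟨s, hs, rfl⟩)
    · exact Or.inl ⟨t⁻¹, (hT.symm t).1 ht, shift_inv t⟩
    · exact Or.inr ⟨s⁻¹, (hS.symm s).1 hs, lamp_inv s⟩
  refine ⟨(hT.finite.image _).union (hS.finite.image _),
    fun w => ⟨hinv w, fun h => by simpa using hinv _ h⟩, ?_⟩
  set K := Subgroup.closure (canonicalGens S T) with hK
  have h1 : ∀ x : H, shift G x ∈ K := by
    intro x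
    have hx : x ∈ Subgroup.closure T := by rw [hT.closure_eq_top]; trivial
    induction hx using Subgroup.closure_induction with
    | mem x hx => exact Subgroup.subset_closure (Or.inl ⟨x, hx, rfl⟩)
    | one => rw [shift_one]; exact K.one_mem
    | mul x y _ _ hx hy => rw [shift_mul]; exact K.mul_mem hx hy
    | inv x _ hx => rw [shift_inv]; exact K.inv_mem hx
  have h2 : ∀ x : G, lamp H x ∈ K := by
    intro x
    have hx : x ∈ Subgroup.closure S := by rw [hS.closure_eq_top]; trivial
    induction hx using Subgroup.closure_induction with
    | mem x hx => exact Subgroup.subset_closure (Or.inr ⟨x, hx, rfl⟩)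
    | one => rw [lamp_one]; exact K.one_mem
    | mul x y _ _ hx hy => rw [lamp_mul]; exact K.mul_mem hx hy
    | inv x _ hx => rw [lamp_inv]; exact K.inv_mem hx
  have h3 : ∀ (F : Finset H) (w : wreath G H), Function.mulSupport w.1.left ⊆ F → w ∈ K := by
    intro F
    induction F using Finset.induction_on with
    | empty =>
      intro w hw
      have : w = shift G w.1.right := by
        apply Subtype.ext
        ext z
        · have : w.1.left = 1 := by simpa using hw
          simp [shift, this]
        · rfl
      rw [this]
      exact h1 _
    | insert a F ha ih =>
      intro w hw
      set u : wreath G H := shift G a * lamp H (w.1.left a) * shift G a⁻¹ with hu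
      have huK : u ∈ K := K.mul_mem (K.mul_mem (h1 _) (h2 _)) (h1 _)
      have hleft : ∀ z, u.1.left z = if z = a then w.1.left a else 1 := by
        intro z
        simp [hu, shift, lamp, Pi.mulSingle_apply, inv_mul_eq_one, eq_comm]
      have hright : u.1.right = 1 := by simp [hu, shift, lamp]
      have key : u⁻¹ * w ∈ K := by
        refine ih _ ?_
        intro z hz
        by_contra hzF
        apply hz
        by_cases hza : z = a
        · simp [hright, hleft, hza]
        · have hwz : w.1.left z = 1 := by
            by_contra hne
            have := hw hne
            simp only [Finset.coe_insert, Set.mem_insert_iff, Finset.mem_coe] at this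
            exact this.elim hza hzF
          simp [hright, hleft, hza, hwz]
      simpa using K.mul_mem huK key
  rw [eq_top_iff]
  intro w _
  have hwf : (Function.mulSupport w.1.left).Finite := w.2
  exact h3 hwf.toFinset w (by simp)

end Compression

end

/-! The base group is undistorted in the wreath product, because evaluating the lamp at the origin
is 1-Lipschitz; this gives the upper bound (`compressionExponent_wreath_le`).

For lower bounds, a trip from `v` to `w` costs at most a constant times `r + σ`, where `r` is how
far from the cursor of `v` one must travel and `σ` is the sum of the distances between differing
lamps (`wordDist_wreath_le`). The embedding (`exists_wreath_map`) combines Lipschitz maps that see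
each part. The ℓ²-sum over all sites of a compression map of `G` detects `∑ d ^ (2α)` in squared
norm. The extent `r` is detected by the cursor and by two trees of configurations on right and left
half-lines; weighted paths to infinity in these trees give `r ^ (2θ)` for any `θ < 1`.

It remains to compare exponents. If `α ≤ 1/2`, the power `2α` is subadditive, so the lamp energy
dominates `σ ^ (2α)`, and `θ = 1/2` suffices. If `α > 1/2`, at most `2r + 1` lamps differ, and the
power mean inequality gives energy at least `σ ^ (2α) / (2r + 1) ^ (2α - 1)`. Either `r` is large
and the trees suffice, or `r` is small and this loss is affordable; balancing the two as `θ → 1`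
yields every `β` with `β (2α + 1) < 2α`. -/

namespace Compression

/-! ### Word lengths and word metrics -/

section WordLength

variable {G : Type*} [Group G] {S : Set G}

theorem wordLength_prod_le (S : Set G) (l : List G) (hl : ∀ s ∈ l, s ∈ S) :
    wordLength S l.prod ≤ l.length :=
  Nat.sInf_le ⟨l, hl, rfl, rfl⟩

/-- Symmetry turns group generation into monoid generation, so the infimum defining the length is
attained and never the default value of `sInf ∅`. -/
theorem IsFiniteSymmGen.exists_word (hS : IsFiniteSymmGen S) (g : G) :
    ∃ l : List G, (∀ s ∈ l, s ∈ S) ∧ l.prod = g ∧ l.length = wordLength S g := by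
  have hne : {n | ∃ l : List G, (∀ s ∈ l, s ∈ S) ∧ l.prod = g ∧ l.length = n}.Nonempty := by
    have hg : g ∈ (Subgroup.closure S).toSubmonoid := by rw [hS.closure_eq_top]; trivial
    rw [Subgroup.closure_toSubmonoid] at hg
    obtain ⟨l, hl, hprod⟩ := Submonoid.exists_list_of_mem_closure hg
    refine ⟨l.length, l, fun s hs => ?_, hprod, rfl⟩
    rcases hl s hs with h | h
    · exact h
    · exact (hS.symm s).2 h
  exact Nat.sInf_mem hne

theorem wordLength_one (S : Set G) : wordLength S (1 : G) = 0 := by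
  simpa using wordLength_prod_le S [] (by simp)

theorem wordLength_le_one {s : G} (hs : s ∈ S) : wordLength S s ≤ 1 := by
  simpa using wordLength_prod_le S [s] (by simpa using hs)

theorem IsFiniteSymmGen.wordLength_mul_le (hS : IsFiniteSymmGen S) (g h : G) :
    wordLength S (g * h) ≤ wordLength S g + wordLength S h := by
  obtain ⟨l, hl, rfl, hlen⟩ := hS.exists_word g
  obtain ⟨m, hm, rfl, hmlen⟩ := hS.exists_word h
  rw [← hlen, ← hmlen, ← List.prod_append, ← List.length_append]
  refine wordLength_prod_le S _ fun s hs => ?_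
  rcases List.mem_append.1 hs with h | h
  · exact hl s h
  · exact hm s h

theorem IsFiniteSymmGen.wordLength_eq_zero (hS : IsFiniteSymmGen S) {g : G} :
    wordLength S g = 0 ↔ g = 1 := by
  refine ⟨fun h => ?_, fun h => h ▸ wordLength_one S⟩
  obtain ⟨l, -, rfl, hlen⟩ := hS.exists_word g
  rw [h, List.length_eq_zero_iff] at hlen
  simp [hlen]

theorem wordDist_self (S : Set G) (x : G) : wordDist S x x = 0 := by
  simp [wordDist, wordLength_one]

theorem IsFiniteSymmGen.wordDist_triangle (hS : IsFiniteSymmGen S) (x y z : G) :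
    wordDist S x z ≤ wordDist S x y + wordDist S y z := by
  have := hS.wordLength_mul_le (x⁻¹ * y) (y⁻¹ * z)
  simpa [wordDist, mul_assoc] using this

theorem IsFiniteSymmGen.one_le_wordDist (hS : IsFiniteSymmGen S) {x y : G} (h : x ≠ y) :
    1 ≤ wordDist S x y := by
  rw [Nat.one_le_iff_ne_zero, wordDist, Ne, hS.wordLength_eq_zero, inv_mul_eq_one]
  exact h

theorem IsFiniteSymmGen.finite_ball (hS : IsFiniteSymmGen S) (n : ℕ) :
    {g : G | wordLength S g ≤ n}.Finite := by
  have := hS.finite.to_subtype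
  refine ((List.finite_length_le S n).image fun l => (l.map Subtype.val).prod).subset ?_
  intro g hg
  obtain ⟨l, hl, rfl, hlen⟩ := hS.exists_word g
  refine ⟨l.attach.map fun s => ⟨s.1, hl s.1 s.2⟩, ?_, ?_⟩
  · simpa [hlen] using hg
  · simp

theorem IsFiniteSymmGen.countable (hS : IsFiniteSymmGen S) : Countable G := by
  rw [← Set.countable_univ_iff]
  have : (Set.univ : Set G) = ⋃ n : ℕ, {g : G | wordLength S g ≤ n} := by
    ext g
    simpa using ⟨_, le_refl (wordLength S g)⟩
  rw [this]
  exact Set.countable_iUnion fun n => (hS.finite_ball n).countable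

/-- A function satisfying the triangle inequality is bounded by its value on generators times the
word metric. -/
theorem IsFiniteSymmGen.le_mul_wordDist (hS : IsFiniteSymmGen S) {D : G → G → ℝ} {L : ℝ}
    (h0 : ∀ x, D x x ≤ 0) (htri : ∀ x y z, D x z ≤ D x y + D y z)
    (hgen : ∀ x, ∀ t ∈ S, D x (x * t) ≤ L) (x y : G) :
    D x y ≤ L * (wordDist S x y : ℝ) := by
  have key : ∀ l : List G, (∀ s ∈ l, s ∈ S) → ∀ x, D x (x * l.prod) ≤ L * l.length := by
    intro l
    induction l with
    | nil => intro _ x; simpa using h0 x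
    | cons s l ih =>
      intro hl x
      have h1 := hgen x s (hl s (by simp))
      have h2 := ih (fun t ht => hl t (by simp [ht])) (x * s)
      have h3 := htri x (x * s) (x * s * l.prod)
      rw [List.prod_cons, ← mul_assoc, List.length_cons]
      push_cast
      linarith
  obtain ⟨l, hl, hprod, hlen⟩ := hS.exists_word (x⁻¹ * y)
  have := key l hl x
  rw [hprod, hlen] at this
  simpa [wordDist] using this

theorem IsFiniteSymmGen.exists_wordDist_map_le {H : Type*} [Group H] {T : Set H}
    (hS : IsFiniteSymmGen S) (hT : IsFiniteSymmGen T) (φ : G →* H) :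
    ∃ C : ℝ, 0 < C ∧ ∀ x y, (wordDist T (φ x) (φ y) : ℝ) ≤ C * (wordDist S x y : ℝ) := by
  obtain ⟨C, hC⟩ := (hS.finite.image fun s => wordLength T (φ s)).bddAbove
  refine ⟨C + 1, by positivity, hS.le_mul_wordDist (fun x => ?_) (fun x y z => ?_) fun x t ht => ?_⟩
  · simp [wordDist_self]
  · exact_mod_cast hT.wordDist_triangle _ _ _
  · have : wordLength T (φ t) ≤ C := hC ⟨t, ht, rfl⟩
    have h2 : wordDist T (φ x) (φ (x * t)) ≤ C + 1 := by
      simpa [wordDist] using this.trans (Nat.le_succ C)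
    exact_mod_cast h2

theorem IsFiniteSymmGen.exists_le_wordLength [Infinite G] (hS : IsFiniteSymmGen S) (n : ℕ) :
    ∃ g : G, n < wordLength S g := by
  obtain ⟨g, hg⟩ := (hS.finite_ball n).exists_notMem
  exact ⟨g, not_le.1 hg⟩

end WordLength

/-! ### General properties of compression exponents -/

section Exponent

variable {G : Type*} [Group G] {S : Set G} {X : Type*} [NormedAddCommGroup X] {α β : ℝ}

/-- Compression passes to subgroups that are not distorted. -/
theorem HasCompression.of_map {H : Type*} [Group H] {T : Set H} (hS : IsFiniteSymmGen S)
    (hT : IsFiniteSymmGen T) (φ : G →* H) (hφ : Function.Injective φ) {C : ℝ} (hC : 0 < C)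
    (hle : ∀ x y, (wordDist S x y : ℝ) ≤ C * (wordDist T (φ x) (φ y) : ℝ)) (hα : 0 ≤ α)
    (h : HasCompression T X α) : HasCompression S X α := by
  obtain ⟨f, ⟨L, hL⟩, c, hc, hf⟩ := h
  obtain ⟨K, hK, hKφ⟩ := hS.exists_wordDist_map_le hT φ
  refine ⟨f ∘ φ, ⟨|L| * K, fun x y => ?_⟩, c / C ^ α, by positivity, fun x y hxy => ?_⟩
  · calc ‖f (φ x) - f (φ y)‖ ≤ L * wordDist T (φ x) (φ y) := hL _ _
      _ ≤ |L| * wordDist T (φ x) (φ y) := by gcongr; exact le_abs_self L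
      _ ≤ |L| * (K * wordDist S x y) := by gcongr; exact hKφ x y
      _ = |L| * K * wordDist S x y := by ring
  · calc c / C ^ α * (wordDist S x y : ℝ) ^ α
        ≤ c / C ^ α * (C * (wordDist T (φ x) (φ y) : ℝ)) ^ α := by gcongr; exact hle x y
      _ = c * (wordDist T (φ x) (φ y) : ℝ) ^ α := by
          rw [Real.mul_rpow hC.le (Nat.cast_nonneg _)]
          field_simp
      _ ≤ ‖f (φ x) - f (φ y)‖ := hf _ _ (hφ.ne hxy)

theorem HasCompression.of_isFiniteSymmGen {T : Set G} (hS : IsFiniteSymmGen S)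
    (hT : IsFiniteSymmGen T) (hα : 0 ≤ α) (h : HasCompression T X α) : HasCompression S X α := by
  obtain ⟨C, hC, hle⟩ := hT.exists_wordDist_map_le hS (MonoidHom.id G)
  exact h.of_map hS hT (MonoidHom.id G) Function.injective_id hC hle hα

/-- The compression exponent does not depend on the generating set. -/
theorem compressionExponent_congr {T : Set G} (hS : IsFiniteSymmGen S) (hT : IsFiniteSymmGen T) :
    compressionExponent S X = compressionExponent T X := by
  unfold compressionExponent
  congr 1
  ext α
  exact ⟨fun h => ⟨h.1, h.2.of_isFiniteSymmGen hT hS h.1⟩,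
    fun h => ⟨h.1, h.2.of_isFiniteSymmGen hS hT h.1⟩⟩

/-- An infinite group has elements of arbitrarily large length `n`, and `c * n ^ α ≤ L * n` then
fails for `α > 1`. This bounds the set whose supremum is the exponent. -/
theorem HasCompression.le_one [Infinite G] (hS : IsFiniteSymmGen S) (h : HasCompression S X α) :
    α ≤ 1 := by
  obtain ⟨f, ⟨L, hL⟩, c, hc, hf⟩ := h
  by_contra! hα
  have htend := tendsto_rpow_atTop (sub_pos.2 hα)
  obtain ⟨N, hN⟩ := Filter.eventually_atTop.1
    ((htend.comp tendsto_natCast_atTop_atTop).eventually_gt_atTop (L / c))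
  obtain ⟨g, hg⟩ := hS.exists_le_wordLength N
  have hpos : (0 : ℝ) < wordLength S g := by exact_mod_cast (Nat.zero_le N).trans_lt hg
  have hg1 : (1 : G) ≠ g := by
    rintro rfl
    simp [wordLength_one] at hg
  have h1 := (hf 1 g hg1).trans (hL 1 g)
  have h2 := hN _ hg.le
  simp only [wordDist, inv_one, one_mul, Function.comp_apply] at h1 h2
  rw [div_lt_iff₀ hc, Real.rpow_sub_one hpos.ne'] at h2
  have h3 := mul_lt_mul_of_pos_right h2 hpos
  have h4 : (wordLength S g : ℝ) ^ α / wordLength S g * c * wordLength S g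
    = c * (wordLength S g : ℝ) ^ α := by field_simp
  linarith

theorem IsFiniteSymmGen.le_compressionExponent [Infinite G] (hS : IsFiniteSymmGen S) (hα : 0 ≤ α)
    (h : HasCompression S X α) : α ≤ compressionExponent S X :=
  le_csSup ⟨1, fun _ hx => hx.2.le_one hS⟩ ⟨hα, h⟩

theorem compressionExponent_nonneg (S : Set G) (X : Type*) [NormedAddCommGroup X] :
    0 ≤ compressionExponent S X :=
  Real.sSup_nonneg fun _ hx => hx.1

theorem exists_hasCompression_of_lt (hβ : 0 ≤ β) (h : β < compressionExponent S X) :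
    ∃ α, β < α ∧ HasCompression S X α := by
  have hne : {α : ℝ | 0 ≤ α ∧ HasCompression S X α}.Nonempty := by
    -- With no admissible exponent the supremum would be the default `0`, which cannot exceed `β ≥
    -- 0`.
    by_contra hempty
    rw [Set.not_nonempty_iff_eq_empty] at hempty
    rw [compressionExponent, hempty, Real.sSup_empty] at h
    exact absurd hβ (not_le.2 h)
  obtain ⟨α, hα, hlt⟩ := exists_lt_of_lt_csSup hne h
  exact ⟨α, hlt, hα.2⟩

theorem HasCompression.mono (hS : IsFiniteSymmGen S) (hβ : β ≤ α) (h : HasCompression S X α) :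
    HasCompression S X β := by
  obtain ⟨f, hL, c, hc, hf⟩ := h
  refine ⟨f, hL, c, hc, fun x y hxy => le_trans ?_ (hf x y hxy)⟩
  gcongr
  exact_mod_cast hS.one_le_wordDist hxy

end Exponent

end Compression

namespace Compression

/-! ### Moving countable subsets of Hilbert spaces into `L2` -/

section Hilbert

open scoped ENNReal

theorem volume_unitInterval_inter_Ioc (n : ℕ) :
    ((volume : Measure ℝ).restrict (Set.Icc 0 1)) (Set.Ioc (1 / (n + 2 : ℝ)) (1 / (n + 1 : ℝ))) ≠ 0 := by
  have hsub : Set.Ioc (1 / (n + 2 : ℝ)) (1 / (n + 1 : ℝ)) ⊆ Set.Icc 0 1 := by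
    intro x hx
    refine ⟨le_trans (by positivity) hx.1.le, hx.2.trans ?_⟩
    rw [div_le_one (by positivity)]
    linarith [(Nat.cast_nonneg n : (0 : ℝ) ≤ n)]
  rw [Measure.restrict_apply measurableSet_Ioc, Set.inter_eq_left.2 hsub, Real.volume_Ioc]
  simp only [ne_eq, ENNReal.ofReal_eq_zero, not_le, sub_pos]
  exact one_div_lt_one_div_of_lt (by positivity) (by linarith)

theorem disjoint_Ioc_one_div {m n : ℕ} (h : m < n) :
    Disjoint (Set.Ioc (1 / (m + 2 : ℝ)) (1 / (m + 1 : ℝ)))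
      (Set.Ioc (1 / (n + 2 : ℝ)) (1 / (n + 1 : ℝ))) := by
  rw [Set.disjoint_left]
  intro x hx hy
  have h1 : (1 : ℝ) / (n + 1) ≤ 1 / (m + 2) := by
    apply one_div_le_one_div_of_le (by positivity)
    have : m + 2 ≤ n + 1 := by omega
    exact_mod_cast this
  exact absurd (hx.1.trans_le hy.2) (not_lt.2 h1)

/-- Normalized indicators of the disjoint intervals `(1/(n+2), 1/(n+1)]`. -/
theorem exists_orthonormal_L2 : ∃ e : ℕ → L2, Orthonormal ℝ e := by
  set μ : Measure ℝ := (volume : Measure ℝ).restrict (Set.Icc 0 1) with hμ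
  set s : ℕ → Set ℝ := fun n => Set.Ioc (1 / (n + 2 : ℝ)) (1 / (n + 1 : ℝ)) with hs
  set v : ℕ → L2 := fun n =>
    indicatorConstLp 2 (measurableSet_Ioc : MeasurableSet (s n)) (measure_ne_top μ _) (1 : ℝ) with hv
  have hinner : ∀ m n, inner ℝ (v m) (v n) = μ.real (s m ∩ s n) := fun m n =>
    L2.real_inner_indicatorConstLp_one_indicatorConstLp_one measurableSet_Ioc measurableSet_Ioc
      (measure_ne_top μ _) (measure_ne_top μ _)
  have hne : ∀ n, v n ≠ 0 := by
    intro n h0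
    have h1 := hinner n n
    rw [h0, inner_zero_left, Set.inter_self, eq_comm, measureReal_eq_zero_iff] at h1
    exact volume_unitInterval_inter_Ioc n h1
  have horth : ∀ m n, m ≠ n → inner ℝ (v m) (v n) = 0 := by
    intro m n hmn
    have hdisj : s m ∩ s n = ∅ := by
      rcases lt_or_gt_of_ne hmn with h | h
      · exact (disjoint_Ioc_one_div h).inter_eq
      · exact (disjoint_Ioc_one_div h).symm.inter_eq
    rw [hinner, hdisj, measureReal_empty]
  refine ⟨fun n => (‖v n‖⁻¹ : ℝ) • v n, fun n => ?_, fun m n hmn => ?_⟩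
  · rw [norm_smul, norm_inv, norm_norm, inv_mul_cancel₀ (norm_ne_zero_iff.2 (hne n))]
  · simp only [inner_smul_left, inner_smul_right, horth m n hmn, mul_zero]

/-- Orthonormal vectors are `√2` apart, so balls of radius `1/2` around them are disjoint, and a
separable space holds only countably many. -/
theorem _root_.Orthonormal.countable_index {E ι : Type*} [NormedAddCommGroup E]
    [InnerProductSpace ℝ E] [TopologicalSpace.SeparableSpace E] {v : ι → E}
    (hv : Orthonormal ℝ v) : Countable ι := by
  have hdist : ∀ i j, i ≠ j → 1 ≤ dist (v i) (v j) := by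
    intro i j hij
    have h : ‖v i - v j‖ ^ 2 = 2 := by
      rw [norm_sub_sq_real, hv.1 i, hv.1 j, hv.2 hij]
      norm_num
    rw [dist_eq_norm]
    nlinarith [norm_nonneg (v i - v j)]
  have hcount : (Set.univ : Set ι).Countable := by
    refine Set.PairwiseDisjoint.countable_of_isOpen (s := fun i => Metric.ball (v i) (1 / 2))
      ?_ (fun _ _ => Metric.isOpen_ball) (fun i _ => ⟨v i, by simp⟩)
    intro i _ j _ hij
    exact Metric.ball_disjoint_ball (by linarith [hdist i j hij])
  exact Set.countable_univ_iff.1 hcount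

/-- A separable Hilbert space embeds isometrically into `L₂`. -/
theorem nonempty_linearIsometry_L2 (E : Type*) [NormedAddCommGroup E] [InnerProductSpace ℝ E]
    [CompleteSpace E] [TopologicalSpace.SeparableSpace E] : Nonempty (E →ₗᵢ[ℝ] L2) := by
  obtain ⟨w, b, -⟩ := exists_hilbertBasis ℝ E
  have : Countable w := b.orthonormal.countable_index
  obtain ⟨i, hi⟩ := exists_injective_nat w
  obtain ⟨e, he⟩ := exists_orthonormal_L2
  have hfam := (he.comp i hi).orthogonalFamily
  exact ⟨hfam.linearIsometry.comp b.repr.toLinearIsometry⟩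

/-- A map from a countable set into a Hilbert space can be moved isometrically into `L₂`. -/
theorem exists_map_L2 {X H : Type*} [Countable X] [NormedAddCommGroup H] [InnerProductSpace ℝ H]
    [CompleteSpace H] (F : X → H) : ∃ F' : X → L2, ∀ x y, ‖F' x - F' y‖ = ‖F x - F y‖ := by
  set V : Submodule ℝ H := (Submodule.span ℝ (Set.range F)).topologicalClosure with hV
  have hsep : TopologicalSpace.IsSeparable (V : Set H) :=
    ((Set.countable_range F).isSeparable.span (R := ℝ)).closure
  have : TopologicalSpace.SeparableSpace V := hsep.separableSpace
  have : CompleteSpace V := (Submodule.isClosed_topologicalClosure _).completeSpace_coe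
  obtain ⟨T⟩ := nonempty_linearIsometry_L2 V
  have hF : ∀ x, F x ∈ V := fun x =>
    Submodule.le_topologicalClosure _ (Submodule.subset_span ⟨x, rfl⟩)
  refine ⟨fun x => T ⟨F x, hF x⟩, fun x y => ?_⟩
  rw [← map_sub, LinearIsometry.norm_map]
  rfl

/-- A family of maps on a group, whose increments along generators are uniformly square summable,
assembles to a Lipschitz map into the direct sum. -/
theorem IsFiniteSymmGen.exists_lipschitz_map_L2 {G : Type*} [Group G] {S : Set G}
    (hS : IsFiniteSymmGen S) {ι : Type*} {H : ι → Type*} [∀ i, NormedAddCommGroup (H i)]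
    [∀ i, InnerProductSpace ℝ (H i)] [∀ i, CompleteSpace (H i)] (F : ∀ i, G → H i) {L : ℝ}
    (hL : 0 ≤ L)
    (hF : ∀ x, ∀ t ∈ S, ∀ s : Finset ι, ∑ i ∈ s, ‖F i x - F i (x * t)‖ ^ 2 ≤ L ^ 2) :
    ∃ Φ : G → L2, (∀ x y, ‖Φ x - Φ y‖ ≤ L * wordDist S x y) ∧
      ∀ x y, ∀ s : Finset ι, ∑ i ∈ s, ‖F i x - F i y‖ ^ 2 ≤ ‖Φ x - Φ y‖ ^ 2 := by
  have := hS.countable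
  have h2 : (2 : ℝ≥0∞).toReal = 2 := rfl
  have hgen : ∀ x, ∀ t ∈ S, Memℓp (fun i => F i x - F i (x * t)) 2 := fun x t ht =>
    memℓp_gen' (C := L ^ 2) fun s => by simpa [h2] using hF x t ht s
  have hword : ∀ l : List G, (∀ t ∈ l, t ∈ S) → ∀ x,
      Memℓp (fun i => F i x - F i (x * l.prod)) 2 := by
    intro l
    induction l with
    | nil => intro _ x; simpa using zero_mem_ℓp'
    | cons t l ih =>
      intro hl x
      have h := (hgen x t (hl t (by simp))).add (ih (fun u hu => hl u (by simp [hu])) (x * t))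
      convert h using 1
      ext i
      simp [mul_assoc]
  have hmem : ∀ x y, Memℓp (fun i => F i x - F i y) 2 := by
    intro x y
    obtain ⟨l, hl, hprod, -⟩ := hS.exists_word (x⁻¹ * y)
    have := hword l hl x
    rwa [hprod, mul_inv_cancel_left] at this
  -- The families themselves need not be square summable; only their increments are, hence the base
  -- point `1` is subtracted.
  set Ψ : G → lp H 2 := fun x => ⟨fun i => F i x - F i 1, hmem x 1⟩ with hΨ
  have hsub : ∀ x y i, (Ψ x - Ψ y) i = F i x - F i y := by
    intro x y i
    rw [lp.coeFn_sub, Pi.sub_apply]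
    exact sub_sub_sub_cancel_right _ _ _
  obtain ⟨Φ, hΦ⟩ := exists_map_L2 Ψ
  refine ⟨Φ, hS.le_mul_wordDist (fun x => by simp) (fun x y z => norm_sub_le_norm_sub_add_norm_sub _ _ _)
    fun x t ht => ?_, fun x y s => ?_⟩
  · rw [hΦ]
    refine lp.norm_le_of_forall_sum_le (by simp) hL fun s => ?_
    simpa only [hsub, h2, Real.rpow_two] using hF x t ht s
  · have := lp.sum_rpow_le_norm_rpow (by simp) (Ψ x - Ψ y) s
    rw [hΦ]
    simpa only [hsub, h2, Real.rpow_two] using this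

end Hilbert

end Compression

namespace Compression

/-! ### Metric geometry of `G ≀ ℤ` -/

section Wreath

open Multiplicative (ofAdd)

variable {G : Type*} [Group G] {S : Set G}

/-- The value of the lamp configuration at the site `z`. -/
def lampAt (w : wreath G (Multiplicative ℤ)) (z : ℤ) : G := w.1.left (Multiplicative.ofAdd z)

/-- The position of the cursor. -/
def cursor (w : wreath G (Multiplicative ℤ)) : ℤ := Multiplicative.toAdd w.1.right

theorem wreath_ext {v w : wreath G (Multiplicative ℤ)} (h : ∀ z, lampAt v z = lampAt w z)
    (hc : cursor v = cursor w) : v = w := by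
  apply Subtype.ext
  ext z
  · exact h (Multiplicative.toAdd z)
  · exact congrArg Multiplicative.ofAdd hc

theorem finite_lampAt_ne_one (w : wreath G (Multiplicative ℤ)) : {z | lampAt w z ≠ 1}.Finite :=
  Set.Finite.preimage (f := Multiplicative.ofAdd) Multiplicative.ofAdd.injective.injOn w.2

theorem finite_lampAt_ne (v w : wreath G (Multiplicative ℤ)) :
    {z | lampAt v z ≠ lampAt w z}.Finite := by
  refine ((finite_lampAt_ne_one v).union (finite_lampAt_ne_one w)).subset fun z hz => ?_
  by_contra h
  simp only [Set.mem_union, Set.mem_ofPred_eq, not_or, not_not] at h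
  exact hz (h.1.trans h.2.symm)

@[simp] theorem cursor_mul (v w : wreath G (Multiplicative ℤ)) :
    cursor (v * w) = cursor v + cursor w := rfl

@[simp] theorem cursor_inv (v : wreath G (Multiplicative ℤ)) : cursor v⁻¹ = -cursor v := rfl

@[simp] theorem lampAt_mul (v w : wreath G (Multiplicative ℤ)) (z : ℤ) :
    lampAt (v * w) z = lampAt v z * lampAt w (z - cursor v) := by
  have : (v.1.right)⁻¹ * ofAdd z = ofAdd (z - cursor v) := by
    rw [sub_eq_neg_add]
    rfl
  simp [lampAt, this]

@[simp] theorem lampAt_inv (v : wreath G (Multiplicative ℤ)) (z : ℤ) :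
    lampAt v⁻¹ z = (lampAt v (z + cursor v))⁻¹ := by
  have : v.1.right * ofAdd z = ofAdd (z + cursor v) := by
    rw [add_comm]
    rfl
  simp [lampAt, this]

@[simp] theorem cursor_shift (x : ℤ) : cursor (shift G (ofAdd x)) = x := rfl

@[simp] theorem cursor_lamp (g : G) : cursor (lamp (Multiplicative ℤ) g) = 0 := rfl

@[simp] theorem lampAt_shift (x : Multiplicative ℤ) (z : ℤ) : lampAt (shift G x) z = 1 := rfl

theorem lampAt_lamp (g : G) (z : ℤ) :
    lampAt (lamp (Multiplicative ℤ) g) z = if z = 0 then g else 1 := by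
  by_cases h : z = 0
  · simp [lampAt, lamp, h]
  · simp [lampAt, lamp, h]

theorem lamp_injective : Function.Injective (lamp (G := G) (Multiplicative ℤ)) := by
  intro g h hgh
  simpa [lampAt_lamp] using congrArg (fun w => lampAt w 0) hgh

/-- The lamp at the origin, as a homomorphism. -/
noncomputable def lampHom (G : Type*) [Group G] : G →* wreath G (Multiplicative ℤ) where
  toFun := lamp (Multiplicative ℤ)
  map_one' := lamp_one
  map_mul' := lamp_mul

/-- The standard generators of `ℤ`. -/
def intGens : Set (Multiplicative ℤ) := {ofAdd 1, ofAdd (-1)}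

theorem isFiniteSymmGen_intGens : IsFiniteSymmGen intGens := by
  refine ⟨by simp [intGens], fun s => ?_, ?_⟩
  · simp only [intGens, Set.mem_insert_iff, Set.mem_singleton_iff, ofAdd_neg,
      inv_eq_iff_eq_inv]
    exact or_comm
  · rw [eq_top_iff]
    rintro x -
    have h1 : ofAdd (1 : ℤ) ∈ Subgroup.closure intGens :=
      Subgroup.subset_closure (Set.mem_insert _ _)
    have : x = (ofAdd (1 : ℤ)) ^ (Multiplicative.toAdd x) := by
      rw [← ofAdd_zsmul]
      simp
    rw [this]
    exact Subgroup.zpow_mem _ h1 _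

theorem isFiniteSymmGen_wreath (hS : IsFiniteSymmGen S) :
    IsFiniteSymmGen (canonicalGens S intGens) :=
  isFiniteSymmGen_canonicalGens hS isFiniteSymmGen_intGens

theorem mem_canonicalGens_intGens {t : wreath G (Multiplicative ℤ)}
    (ht : t ∈ canonicalGens S intGens) :
    (t = shift G (ofAdd 1) ∨ t = shift G (ofAdd (-1))) ∨
      ∃ s ∈ S, t = lamp (Multiplicative ℤ) s := by
  rcases ht with ⟨x, rfl | rfl, rfl⟩ | ⟨s, hs, rfl⟩
  · exact Or.inl (Or.inl rfl)
  · exact Or.inl (Or.inr rfl)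
  · exact Or.inr ⟨s, hs, rfl⟩

theorem wordLength_shift_le (hS : IsFiniteSymmGen S) (x : ℤ) :
    wordLength (canonicalGens S intGens) (shift G (ofAdd x)) ≤ x.natAbs := by
  have hC := isFiniteSymmGen_wreath hS
  have hε : ∀ ε : ℤ, (ε = 1 ∨ ε = -1) → ∀ n : ℕ,
      wordLength (canonicalGens S intGens) (shift G (ofAdd (ε * n))) ≤ n := by
    intro ε hε n
    induction n with
    | zero => simp [shift_one, wordLength_one]
    | succ n ih =>
      have hgen : shift G (ofAdd ε) ∈ canonicalGens S intGens := by
        refine Or.inl ⟨_, ?_, rfl⟩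
        rcases hε with rfl | rfl <;> simp [intGens]
      rw [Nat.cast_succ, mul_add, mul_one, ofAdd_add, shift_mul]
      exact (hC.wordLength_mul_le _ _).trans (add_le_add ih (wordLength_le_one hgen))
  rcases Int.natAbs_eq x with h | h
  · have := hε 1 (Or.inl rfl) x.natAbs
    rwa [one_mul, ← h] at this
  · have := hε (-1) (Or.inr rfl) x.natAbs
    rwa [neg_one_mul, ← h] at this

theorem wordLength_lamp_le (hS : IsFiniteSymmGen S) (g : G) :
    wordLength (canonicalGens S intGens) (lamp (Multiplicative ℤ) g) ≤ wordLength S g := by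
  obtain ⟨l, hl, rfl, hlen⟩ := hS.exists_word g
  have h : lamp (Multiplicative ℤ) l.prod = (l.map (lamp (Multiplicative ℤ))).prod :=
    map_list_prod (lampHom G) l
  rw [h, ← hlen, ← List.length_map (lamp (Multiplicative ℤ))]
  refine wordLength_prod_le _ _ fun s hs => ?_
  obtain ⟨a, ha, rfl⟩ := List.mem_map.1 hs
  exact Or.inr ⟨a, hl a ha, rfl⟩

/-- Sweeping over an interval and lighting the lamps on the way. -/
theorem wordLength_sweep_le (hS : IsFiniteSymmGen S) (p : ℤ) (k : ℕ)
    (v : wreath G (Multiplicative ℤ)) (hc : cursor v = p + k)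
    (hv : ∀ z, lampAt v z ≠ 1 → p ≤ z ∧ z < p + k) :
    wordLength (canonicalGens S intGens) v ≤
      p.natAbs + k + ∑ i ∈ Finset.range k, wordLength S (lampAt v (p + i)) := by
  have hC := isFiniteSymmGen_wreath hS
  induction k generalizing v with
  | zero =>
    have : v = shift G (ofAdd p) := by
      refine wreath_ext (fun z => ?_) (by simpa using hc)
      rw [lampAt_shift]
      by_contra hz
      have := hv z hz
      simp only [Nat.cast_zero] at this
      omega
    simpa [this] using wordLength_shift_le hS p
  | succ k ih =>
    set g := lampAt v (p + k) with hg
    -- Undo the last stage of the sweep: step back to site `p + k` and switch its lamp off.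
    set u := v * shift G (ofAdd (-1)) * lamp (Multiplicative ℤ) g⁻¹ with hu
    have hvu : v = u * lamp (Multiplicative ℤ) g * shift G (ofAdd 1) := by
      rw [hu, mul_assoc _ (lamp _ _) (lamp _ _), ← lamp_mul, inv_mul_cancel, lamp_one, mul_one,
        mul_assoc, ← shift_mul, ← ofAdd_add, neg_add_cancel, ofAdd_zero, shift_one, mul_one]
    have hcu : cursor u = p + k := by
      rw [hu, cursor_mul, cursor_mul, cursor_shift, cursor_lamp, hc]
      push_cast
      ring
    have hlu : ∀ z, lampAt u z = if z = p + k then 1 else lampAt v z := by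
      intro z
      rw [hu, lampAt_mul, lampAt_mul, lampAt_shift, lampAt_lamp, cursor_mul, cursor_shift, hc]
      have : z - (p + ((k + 1 : ℕ) : ℤ) + -1) = 0 ↔ z = p + k := by
        push_cast
        constructor <;> intro h <;> linarith
      simp only [this]
      split_ifs with h
      · simp [h, hg]
      · simp
    have h1 := ih u hcu (by
      intro z hz
      rw [hlu] at hz
      split_ifs at hz with h
      · exact absurd rfl hz
      · have := hv z hz
        push_cast at this
        omega)
    have h2 : ∑ i ∈ Finset.range k, wordLength S (lampAt u (p + i)) =
        ∑ i ∈ Finset.range k, wordLength S (lampAt v (p + i)) := by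
      refine Finset.sum_congr rfl fun i hi => ?_
      have : (i : ℤ) < k := by exact_mod_cast Finset.mem_range.1 hi
      rw [hlu, if_neg (by omega)]
    have h3 := hC.wordLength_mul_le (u * lamp (Multiplicative ℤ) g) (shift G (ofAdd 1))
    have h4 := hC.wordLength_mul_le u (lamp (Multiplicative ℤ) g)
    have h5 := wordLength_lamp_le hS g
    have h6 := wordLength_shift_le hS 1
    rw [← hvu] at h3
    rw [Finset.sum_range_succ, ← hg, ← h2]
    simp only [Int.natAbs_one] at h6
    omega

/-- Walk to `-r`, sweep across `[-r, r]`, then return from `r + 1` to the final cursor: the moves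
cost at most `r + (2r + 1) + (2r + 1) = 5r + 2`. -/
theorem wordLength_wreath_le (hS : IsFiniteSymmGen S) (r : ℕ) (v : wreath G (Multiplicative ℤ))
    (hc : (cursor v).natAbs ≤ r) (hv : ∀ z, lampAt v z ≠ 1 → z.natAbs ≤ r) (D : Finset ℤ)
    (hD : ∀ z, lampAt v z ≠ 1 → z ∈ D) :
    wordLength (canonicalGens S intGens) v ≤ 5 * r + 2 + ∑ z ∈ D, wordLength S (lampAt v z) := by
  classical
  have hC := isFiniteSymmGen_wreath hS
  set u := v * shift G (ofAdd (r + 1 - cursor v)) with hu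
  have hlu : ∀ z, lampAt u z = lampAt v z := fun z => by simp [hu]
  have h1 := wordLength_sweep_le hS (-r) (2 * r + 1) u
    (by rw [hu, cursor_mul, cursor_shift]; push_cast; ring)
    (fun z hz => by
      have := hv z (hlu z ▸ hz)
      push_cast
      omega)
  have hvu : v = u * shift G (ofAdd (-(r + 1 - cursor v))) := by
    rw [hu, mul_assoc, ← shift_mul, ← ofAdd_add, add_neg_cancel, ofAdd_zero, shift_one, mul_one]
  have h2 := hC.wordLength_mul_le u (shift G (ofAdd (-(r + 1 - cursor v))))
  rw [← hvu] at h2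
  have h3 := wordLength_shift_le hS (-(r + 1 - cursor v))
  have h4 : ∑ i ∈ Finset.range (2 * r + 1), wordLength S (lampAt u (-r + i)) ≤
      ∑ z ∈ D, wordLength S (lampAt v z) := by
    have hinj : Function.Injective fun i : ℕ => (-r + i : ℤ) := fun a b h => by simpa using h
    rw [← Finset.sum_image (f := fun z => wordLength S (lampAt u z)) hinj.injOn]
    simp only [hlu]
    rw [← Finset.sum_filter_of_ne (p := fun z => lampAt v z ≠ 1)]
    · refine Finset.sum_le_sum_of_subset fun z hz => hD z (Finset.mem_filter.1 hz).2
    · intro z _ hz h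
      exact hz (h ▸ wordLength_one S)
  omega

/-- Upper bound for the word metric of `G ≀ ℤ`. -/
theorem wordDist_wreath_le (hS : IsFiniteSymmGen S) (r : ℕ) {v w : wreath G (Multiplicative ℤ)}
    (hc : (cursor w - cursor v).natAbs ≤ r) (D : Finset ℤ)
    (hD : ∀ z, z ∈ D ↔ lampAt v z ≠ lampAt w z) (hr : ∀ z ∈ D, (z - cursor v).natAbs ≤ r)
    (hvw : v ≠ w) :
    wordDist (canonicalGens S intGens) v w ≤
      7 * (r + ∑ z ∈ D, wordDist S (lampAt v z) (lampAt w z)) := by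
  have hlamp : ∀ z, lampAt (v⁻¹ * w) z = (lampAt v (z + cursor v))⁻¹ * lampAt w (z + cursor v) := by
    intro z
    simp
  have hmem : ∀ z, lampAt (v⁻¹ * w) z ≠ 1 → z + cursor v ∈ D := by
    intro z hz
    rw [hlamp, Ne, inv_mul_eq_one] at hz
    exact (hD _).2 hz
  have h1 := wordLength_wreath_le hS r (v⁻¹ * w)
    (by rw [cursor_mul, cursor_inv]; rwa [neg_add_eq_sub])
    (fun z hz => by simpa using hr _ (hmem z hz)) (D.image fun z => z - cursor v)
    (fun z hz => Finset.mem_image.2 ⟨_, hmem z hz, by ring⟩)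
  rw [Finset.sum_image fun a _ b _ h => by simpa using h] at h1
  simp only [hlamp, sub_add_cancel] at h1
  -- Since `v ≠ w`, this total is at least `1` and absorbs the additive `2`, which leads to the
  -- factor `7`.
  have h2 : 1 ≤ r + ∑ z ∈ D, wordDist S (lampAt v z) (lampAt w z) := by
    rcases Finset.eq_empty_or_nonempty D with h | ⟨z, hz⟩
    · by_contra hlt
      refine hvw (wreath_ext (fun z => ?_) ?_)
      · by_contra hz
        have := (hD z).2 hz
        simp [h] at this
      · omega
    · have h3 := hS.one_le_wordDist ((hD z).1 hz)
      have h4 : wordDist S (lampAt v z) (lampAt w z) ≤ _ := Finset.single_le_sum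
        (f := fun z => wordDist S (lampAt v z) (lampAt w z)) (fun _ _ => Nat.zero_le _) hz
      exact h3.trans (h4.trans (Nat.le_add_left _ _))
  change _ ≤ 5 * r + 2 + ∑ z ∈ D, wordDist S (lampAt v z) (lampAt w z) at h1
  unfold wordDist at h1 h2 ⊢
  omega

/-- One generator moves the lamp at the origin by at most one letter of `S`. -/
theorem wordDist_le_wordDist_lamp (hS : IsFiniteSymmGen S) (g h : G) :
    (wordDist S g h : ℝ) ≤
      wordDist (canonicalGens S intGens) (lamp (Multiplicative ℤ) g) (lamp _ h) := by
  have hC := isFiniteSymmGen_wreath hS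
  have := hC.le_mul_wordDist (D := fun v w => (wordDist S (lampAt v 0) (lampAt w 0) : ℝ)) (L := 1)
    (fun x => by simp [wordDist_self]) (fun x y z => by exact_mod_cast hS.wordDist_triangle _ _ _)
    (fun x t ht => ?_) (lamp _ g) (lamp _ h)
  · simpa [lampAt_lamp] using this
  · rcases mem_canonicalGens_intGens ht with (rfl | rfl) | ⟨s, hs, rfl⟩
    · simp [wordDist_self]
    · simp [wordDist_self]
    · rw [lampAt_mul, lampAt_lamp]
      split_ifs
      · simpa [wordDist] using wordLength_le_one hs
      · simp [wordDist_self]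

instance [Infinite G] : Infinite (wreath G (Multiplicative ℤ)) :=
  Infinite.of_injective _ (lamp_injective (G := G))

/-- The base group is undistorted in `G ≀ ℤ`. -/
theorem compressionExponent_wreath_le [Infinite G] (hS : IsFiniteSymmGen S) (X : Type*)
    [NormedAddCommGroup X] :
    compressionExponent (canonicalGens S intGens) X ≤ compressionExponent S X := by
  refine Real.sSup_le (fun α hα => ?_) (compressionExponent_nonneg S X)
  refine hS.le_compressionExponent hα.1 (hα.2.of_map hS (isFiniteSymmGen_wreath hS) (lampHom G)
    lamp_injective one_pos (fun x y => ?_) hα.1)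
  rw [one_mul]
  exact wordDist_le_wordDist_lamp hS x y

end Wreath

end Compression

namespace Compression

/-! ### The weights `k ^ a` and their increments -/

section Ramp

/-- Write `k ^ p = k * k ^ (p - 1)` and use that the power `p - 1 ≤ 0` is decreasing. -/
theorem rpow_sub_rpow_le {p k : ℝ} (hp1 : p ≤ 1) (hk : 1 ≤ k) :
    k ^ p - (k - 1) ^ p ≤ k ^ (p - 1) := by
  have hk0 : 0 < k := by linarith
  have h1 : k ^ p = k * k ^ (p - 1) := by
    rw [Real.rpow_sub_one hk0.ne']
    field_simp
  have h2 : (k - 1) * k ^ (p - 1) ≤ (k - 1) ^ p := by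
    rcases hk.eq_or_lt with rfl | hk
    · simpa using Real.rpow_nonneg le_rfl p
    · have hk' : 0 < k - 1 := by linarith
      have h3 : (k - 1) ^ p = (k - 1) * (k - 1) ^ (p - 1) := by
        rw [Real.rpow_sub_one hk'.ne']
        field_simp
      rw [h3]
      exact mul_le_mul_of_nonneg_left
        (Real.rpow_le_rpow_of_nonpos hk' (by linarith) (by linarith)) hk'.le
  linarith

/-- Each increment of `M ^ (p + 1)` is at most `2 (M + 1) ^ p`, whence the factor `1/2`. -/
theorem rpow_add_one_le_sum {p : ℝ} (hp0 : 0 ≤ p) (hp1 : p ≤ 1) (M : ℕ) :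
    (M : ℝ) ^ (p + 1) / 2 ≤ ∑ i ∈ Finset.range M, ((i : ℝ) + 1) ^ p := by
  induction M with
  | zero => simp [Real.zero_rpow (by linarith : p + 1 ≠ 0)]
  | succ M ih =>
    rw [Finset.sum_range_succ]
    have hM : (0 : ℝ) ≤ M := Nat.cast_nonneg M
    have hM1 : (0 : ℝ) < (M : ℝ) + 1 := by linarith
    have h1 := rpow_sub_rpow_le hp1 (k := (M : ℝ) + 1) (by linarith)
    rw [add_sub_cancel_right] at h1
    have h2 : ((M : ℝ) + 1) ^ p = ((M : ℝ) + 1) * ((M : ℝ) + 1) ^ (p - 1) := by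
      rw [Real.rpow_sub_one hM1.ne']
      field_simp
    have h3 : ((M : ℝ) + 1) ^ (p + 1) = ((M : ℝ) + 1) * ((M : ℝ) + 1) ^ p := by
      rw [Real.rpow_add_one hM1.ne', mul_comm]
    have h4 : (M : ℝ) ^ (p + 1) = M * (M : ℝ) ^ p := by
      rw [Real.rpow_add_one' hM (by linarith), mul_comm]
    have h5 : 0 ≤ ((M : ℝ) + 1) ^ (p - 1) := by positivity
    push_cast
    rw [h3]
    rw [h4] at ih
    have h6 : (M : ℝ) * (((M : ℝ) + 1) ^ p - (M : ℝ) ^ p) ≤ M * ((M : ℝ) + 1) ^ (p - 1) := by gcongr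
    nlinarith

/-- The function `k ↦ k ^ a`, extended by zero to the integers `k ≤ 0`. -/
noncomputable def ramp (a : ℝ) (k : ℤ) : ℝ := if 0 < k then (k : ℝ) ^ a else 0

theorem ramp_of_nonpos (a : ℝ) {k : ℤ} (hk : k ≤ 0) : ramp a k = 0 := if_neg (not_lt.2 hk)

theorem sq_ramp_sub_le {a : ℝ} (h0 : 0 ≤ a) (h1 : a ≤ 1) (k : ℤ) :
    (ramp a k - ramp a (k - 1)) ^ 2 ≤ if 0 < k then (k : ℝ) ^ (2 * a - 2) else 0 := by
  split_ifs with hk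
  · have hk1 : (1 : ℝ) ≤ k := by exact_mod_cast hk
    have hk' : (0 : ℝ) ≤ (k : ℝ) - 1 := by linarith
    have hprev : ramp a k - ramp a (k - 1) ≤ (k : ℝ) ^ (a - 1) ∧ ramp a (k - 1) ≤ ramp a k := by
      rcases (show (1 : ℤ) ≤ k from hk).eq_or_lt with rfl | hk2
      · simp [ramp]
      · have hle := rpow_sub_rpow_le h1 hk1
        have hmono : (k - 1 : ℝ) ^ a ≤ (k : ℝ) ^ a := by gcongr; linarith
        have : 0 < k - 1 := by omega
        simp only [ramp, if_pos hk, if_pos this]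
        push_cast
        exact ⟨hle, hmono⟩
    have h2 : (k : ℝ) ^ (2 * a - 2) = ((k : ℝ) ^ (a - 1)) ^ 2 := by
      rw [← Real.rpow_natCast, ← Real.rpow_mul (by linarith)]
      congr 1
      push_cast
      ring
    rw [h2]
    exact pow_le_pow_left₀ (sub_nonneg.2 hprev.2) hprev.1 2
  · rw [ramp_of_nonpos a (by omega), ramp_of_nonpos a (by omega)]
    simp

/-- Squared increments of the ramp are at most `k ^ (2a - 2)`, which is summable exactly because `a
< 1/2`. This makes the tree map Lipschitz under cursor moves, and restricts `θ = a + 1/2` to `θ <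
1`. -/
theorem exists_sum_sq_ramp_sub_le {a : ℝ} (h0 : 0 ≤ a) (h1 : a < 1 / 2) :
    ∃ A : ℝ, 0 ≤ A ∧ ∀ c δ : ℤ, (δ = 1 ∨ δ = -1) → ∀ s : Finset ℤ,
      ∑ n ∈ s, (ramp a (n - c) - ramp a (n - (c + δ))) ^ 2 ≤ A ^ 2 := by
  set g : ℤ → ℝ := fun k => if 0 < k then (k : ℝ) ^ (2 * a - 2) else 0 with hg
  have hg0 : ∀ k, 0 ≤ g k := by
    intro k
    simp only [hg]
    split_ifs with hk
    · have : (0 : ℝ) < k := by exact_mod_cast hk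
      positivity
    · exact le_rfl
  have hsum : Summable g := by
    refine Summable.of_nat_of_neg ?_ ?_
    · refine Summable.of_nonneg_of_le (fun n => hg0 n) (fun n => ?_)
        (Real.summable_nat_rpow.2 (by linarith : 2 * a - 2 < -1))
      simp only [hg]
      split_ifs
      · simp
      · positivity
    · convert summable_zero with n
      simp [hg]
  have hkey : ∀ s : Finset ℤ, ∑ k ∈ s, (ramp a k - ramp a (k - 1)) ^ 2 ≤ ∑' k, g k := fun s =>
    (Finset.sum_le_sum fun k _ => sq_ramp_sub_le h0 (by linarith) k).trans
      (hsum.sum_le_tsum s fun k _ => hg0 k)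
  refine ⟨√(∑' k, g k), Real.sqrt_nonneg _, fun c δ hδ s => ?_⟩
  rw [Real.sq_sqrt (tsum_nonneg hg0)]
  rcases hδ with rfl | rfl
  · refine le_trans (le_of_eq ?_) (hkey (s.image fun n => n - c))
    rw [Finset.sum_image fun x _ y _ h => by simpa using h]
    exact Finset.sum_congr rfl fun n _ => by rw [sub_sub]
  · refine le_trans (le_of_eq ?_) (hkey (s.image fun n => n - c + 1))
    rw [Finset.sum_image fun x _ y _ h => by simpa using h]
    refine Finset.sum_congr rfl fun n _ => ?_
    rw [add_sub_cancel_right, ← neg_sub, neg_sq]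
    congr 3
    ring

end Ramp

/-! ### The tree of half-line configurations -/

section Tree

variable {G : Type*} [Group G] {S : Set G}

open Multiplicative (ofAdd)
open scoped lp

/-- The restriction of `f` to the half-line `[n, ∞)`. -/
noncomputable def restrictGE (n : ℤ) (f : ℤ → G) : ℤ → G := fun z => if n ≤ z then f z else 1

open Classical in
/-- The coordinate at height `n` of the weighted path from the vertex `f|[x, ∞)` towards infinity in
the tree of configurations on half-lines. -/
noncomputable def treeCoord (a : ℝ) (f : ℤ → G) (x n : ℤ) : ℓ²(ℤ → G, ℝ) :=
  lp.single 2 (restrictGE n f) (ramp a (n - x))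

theorem norm_treeCoord_sub (a : ℝ) (f : ℤ → G) (x y n : ℤ) :
    ‖treeCoord a f x n - treeCoord a f y n‖ = |ramp a (n - x) - ramp a (n - y)| := by
  classical
  rw [treeCoord, treeCoord, ← lp.single_sub, lp.norm_single (by norm_num), Real.norm_eq_abs]

/-- The lamp under the cursor is invisible: for `n ≤ x` the weight vanishes, and for `n > x` the
restriction omits `x`. Hence lamp generators do not move the image. -/
theorem treeCoord_congr (a : ℝ) {f g : ℤ → G} {x : ℤ} (h : ∀ z, z ≠ x → f z = g z) (n : ℤ) :
    treeCoord a f x n = treeCoord a g x n := by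
  rcases le_or_gt n x with hn | hn
  · simp [treeCoord, ramp_of_nonpos a (sub_nonpos.2 hn)]
  · have : restrictGE n f = restrictGE n g := by
      ext z
      simp only [restrictGE]
      split_ifs with hz
      · exact h z (by omega)
      · rfl
    rw [treeCoord, treeCoord, this]

/-- Below a disagreement the two restrictions are different vertices, so their basis vectors are
orthogonal and the weight of the first cannot cancel. -/
theorem sq_ramp_le_norm_treeCoord_sub (a : ℝ) {f g : ℤ → G} {m n : ℤ} (h : f m ≠ g m) (hn : n ≤ m)
    (x y : ℤ) : ramp a (n - x) ^ 2 ≤ ‖treeCoord a f x n - treeCoord a g y n‖ ^ 2 := by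
  classical
  have hne : restrictGE n f ≠ restrictGE n g := by
    intro heq
    have := congrFun heq m
    simp only [restrictGE, if_pos hn] at this
    exact h this
  have h1 := lp.norm_apply_le_norm (by norm_num) (treeCoord a f x n - treeCoord a g y n)
    (restrictGE n f)
  rw [lp.coeFn_sub, Pi.sub_apply, treeCoord, treeCoord, lp.single_apply_self,
    lp.single_apply_ne _ _ _ hne, sub_zero, Real.norm_eq_abs] at h1
  rw [← sq_abs]
  exact pow_le_pow_left₀ (abs_nonneg _) h1 2

/-- The map of `G ≀ ℤ` to the tree of configurations on half-lines. -/
theorem exists_tree_map (hS : IsFiniteSymmGen S) {a : ℝ} (h0 : 0 ≤ a) (h1 : a < 1 / 2) {ε : ℤ}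
    (hε : ε = 1 ∨ ε = -1) : ∃ Φ : wreath G (Multiplicative ℤ) → L2,
      (∃ L : ℝ, ∀ v w, ‖Φ v - Φ w‖ ≤ L * wordDist (canonicalGens S intGens) v w) ∧
      ∀ v w z, lampAt v z ≠ lampAt w z → ∀ r : ℕ, ε * (z - cursor v) = r →
        (r : ℝ) ^ (2 * a + 1) / 2 ≤ ‖Φ v - Φ w‖ ^ 2 := by
  obtain ⟨A, hA, hsum⟩ := exists_sum_sq_ramp_sub_le h0 h1
  have hεε : ε * ε = 1 := by rcases hε with rfl | rfl <;> rfl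
  -- Multiplication by `ε = -1` reflects the line, so the same construction serves left half-lines.
  obtain ⟨Φ, hL, hΦ⟩ := (isFiniteSymmGen_wreath hS).exists_lipschitz_map_L2
    (fun n w => treeCoord a (fun z => lampAt w (ε * z)) (ε * cursor w) n) hA (fun w t ht s => by
      have hshift : ∀ δ : ℤ, (δ = 1 ∨ δ = -1) →
          ∑ n ∈ s, ‖treeCoord a (fun z => lampAt w (ε * z)) (ε * cursor w) n -
            treeCoord a (fun z => lampAt (w * shift G (ofAdd δ)) (ε * z))
              (ε * cursor (w * shift G (ofAdd δ))) n‖ ^ 2 ≤ A ^ 2 := by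
        intro δ hδ
        simp only [lampAt_mul, lampAt_shift, mul_one, cursor_mul, cursor_shift, mul_add,
          norm_treeCoord_sub, sq_abs]
        refine hsum _ _ ?_ s
        rcases hε with rfl | rfl <;> rcases hδ with rfl | rfl <;> simp
      rcases mem_canonicalGens_intGens ht with (rfl | rfl) | ⟨g, -, rfl⟩
      · exact hshift 1 (Or.inl rfl)
      · exact hshift (-1) (Or.inr rfl)
      · refine (Finset.sum_nonpos fun n _ => le_of_eq ?_).trans (sq_nonneg A)
        rw [cursor_mul, cursor_lamp, add_zero, treeCoord_congr a (f := fun z => lampAt w (ε * z))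
          (g := fun z => lampAt (w * lamp _ g) (ε * z)), sub_self]
        · simp
        · intro z hz
          have : ε * z - cursor w ≠ 0 := by
            intro h
            apply hz
            rw [← sub_eq_zero.1 h, ← mul_assoc, hεε, one_mul]
          simp [lampAt_lamp, this])
  refine ⟨Φ, ⟨A, hL⟩, fun v w z hz r hr => ?_⟩
  set x := ε * cursor v with hx
  -- Only the heights `x + 1, …, x + r = ε * z` are kept: there the configurations still disagree at
  -- `ε * z`, and the weights are `1 ^ a, …, r ^ a`.
  have hinj : Function.Injective fun i : ℕ => (x + 1 + i : ℤ) := fun i j h => by simpa using h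
  have h2 := hΦ v w ((Finset.range r).image fun i : ℕ => (x + 1 + i : ℤ))
  rw [Finset.sum_image hinj.injOn] at h2
  refine le_trans (rpow_add_one_le_sum (by linarith) (by linarith) r) (le_trans ?_ h2)
  refine Finset.sum_le_sum fun i hi => ?_
  have hi' : (i : ℤ) < r := by exact_mod_cast Finset.mem_range.1 hi
  refine le_trans (le_of_eq ?_) (sq_ramp_le_norm_treeCoord_sub a (m := ε * z) ?_ ?_ _ _)
  · have h3 : x + 1 + (i : ℤ) - ε * cursor v = i + 1 := by rw [hx]; ring
    have h4 : (0 : ℤ) < i + 1 := by omega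
    rw [h3, ramp, if_pos h4, ← Real.rpow_natCast, ← Real.rpow_mul (by push_cast; positivity)]
    push_cast
    congr 1
    ring
  · simpa only [← mul_assoc, hεε, one_mul] using hz
  · rw [mul_sub] at hr
    omega

end Tree

/-! ### Assembling the embedding of `G ≀ ℤ` -/

section Embedding

variable {G : Type*} [Group G] {S : Set G}

/-- The tree bounds need a distant differing lamp; this map covers the case where only the cursor
travels far. -/
theorem exists_cursor_map (hS : IsFiniteSymmGen S) : ∃ Φ : wreath G (Multiplicative ℤ) → L2,
      (∃ L : ℝ, ∀ v w, ‖Φ v - Φ w‖ ≤ L * wordDist (canonicalGens S intGens) v w) ∧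
      ∀ v w, ((cursor w - cursor v).natAbs : ℝ) ^ 2 ≤ ‖Φ v - Φ w‖ ^ 2 := by
  obtain ⟨Φ, hL, hΦ⟩ := (isFiniteSymmGen_wreath hS).exists_lipschitz_map_L2
    (ι := Unit) (H := fun _ => ℝ) (fun _ w => (cursor w : ℝ)) zero_le_one (fun w t ht s => by
      refine (Finset.sum_le_sum_of_subset_of_nonneg (Finset.subset_univ s)
        fun _ _ _ => sq_nonneg _).trans ?_
      rcases mem_canonicalGens_intGens ht with (rfl | rfl) | ⟨g, -, rfl⟩ <;> simp [-ofAdd_neg])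
  refine ⟨Φ, ⟨1, hL⟩, fun v w => le_trans (le_of_eq ?_) (hΦ v w Finset.univ)⟩
  simp only [Finset.univ_unique, Finset.sum_singleton, Real.norm_eq_abs, sq_abs]
  rw [Nat.cast_natAbs, Int.cast_abs, sq_abs]
  push_cast
  ring

/-- A generator alters at most one lamp, and that one by a letter of `S`, so the ℓ²-sum over sites
stays Lipschitz. -/
theorem exists_lamps_map (hS : IsFiniteSymmGen S) {φ : G → L2} {L : ℝ}
    (hφ : ∀ x y, ‖φ x - φ y‖ ≤ L * wordDist S x y) : ∃ Φ : wreath G (Multiplicative ℤ) → L2,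
      (∃ L : ℝ, ∀ v w, ‖Φ v - Φ w‖ ≤ L * wordDist (canonicalGens S intGens) v w) ∧
      ∀ v w, ∀ D : Finset ℤ,
        ∑ z ∈ D, ‖φ (lampAt v z) - φ (lampAt w z)‖ ^ 2 ≤ ‖Φ v - Φ w‖ ^ 2 := by
  obtain ⟨Φ, hL, hΦ⟩ := (isFiniteSymmGen_wreath hS).exists_lipschitz_map_L2
    (ι := ℤ) (H := fun _ => L2) (fun z w => φ (lampAt w z)) (abs_nonneg L) (fun w t ht s => by
      rcases mem_canonicalGens_intGens ht with (rfl | rfl) | ⟨g, hg, rfl⟩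
      · simpa using sq_nonneg L
      · simpa using sq_nonneg L
      · have h1 : ∀ z, ‖φ (lampAt w z) - φ (lampAt (w * lamp _ g) z)‖ ^ 2 ≤
            if z = cursor w then |L| ^ 2 else 0 := by
          intro z
          rw [lampAt_mul, lampAt_lamp]
          simp only [sub_eq_zero]
          split_ifs with hz
          · refine pow_le_pow_left₀ (norm_nonneg _) ?_ 2
            have h2 : (wordDist S (lampAt w z) (lampAt w z * g) : ℝ) ≤ 1 := by
              simpa [wordDist] using wordLength_le_one hg
            calc _ ≤ L * wordDist S (lampAt w z) (lampAt w z * g) := hφ _ _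
              _ ≤ |L| * 1 := by gcongr; exact le_abs_self L
              _ = |L| := mul_one _
          · simp
        refine (Finset.sum_le_sum fun z _ => h1 z).trans ?_
        rw [Finset.sum_ite_eq']
        split_ifs
        · exact le_rfl
        · positivity)
  exact ⟨Φ, ⟨|L|, hL⟩, hΦ⟩

/-- Finitely many Lipschitz maps can be dominated by a single one. -/
theorem IsFiniteSymmGen.exists_map_dominating (hS : IsFiniteSymmGen S) {ι : Type*} [Fintype ι]
    (F : ι → G → L2) (hF : ∀ i, ∃ L : ℝ, ∀ x y, ‖F i x - F i y‖ ≤ L * wordDist S x y) :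
    ∃ Φ : G → L2, (∃ L : ℝ, ∀ x y, ‖Φ x - Φ y‖ ≤ L * wordDist S x y) ∧
      ∀ i x y, ‖F i x - F i y‖ ^ 2 ≤ ‖Φ x - Φ y‖ ^ 2 := by
  choose L hL using hF
  obtain ⟨Φ, hΦL, hΦ⟩ := hS.exists_lipschitz_map_L2 F (L := √(∑ i, |L i| ^ 2))
    (Real.sqrt_nonneg _) (fun x t ht s => by
      rw [Real.sq_sqrt (Finset.sum_nonneg fun _ _ => sq_nonneg _)]
      refine (Finset.sum_le_sum_of_subset_of_nonneg (Finset.subset_univ s)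
        fun _ _ _ => sq_nonneg _).trans (Finset.sum_le_sum fun i _ => ?_)
      refine pow_le_pow_left₀ (norm_nonneg _) ?_ 2
      have h2 : (wordDist S x (x * t) : ℝ) ≤ 1 := by
        simpa [wordDist] using wordLength_le_one ht
      calc _ ≤ L i * wordDist S x (x * t) := hL i _ _
        _ ≤ |L i| * 1 := by gcongr; exact le_abs_self _
        _ = |L i| := mul_one _)
  exact ⟨Φ, ⟨_, hΦL⟩, fun i x y => by simpa using hΦ x y {i}⟩

/-- The embedding of `G ≀ ℤ`: it controls the extent `r` of the trip from `v` to `w`, and the sum of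
the powers of the distances between the lamps. -/
theorem exists_wreath_map (hS : IsFiniteSymmGen S) {α θ : ℝ} (h : HasCompression S L2 α)
    (hθ : 1 / 2 ≤ θ) (hθ1 : θ < 1) :
    ∃ Φ : wreath G (Multiplicative ℤ) → L2,
      (∃ L : ℝ, ∀ v w, ‖Φ v - Φ w‖ ≤ L * wordDist (canonicalGens S intGens) v w) ∧
      ∃ c : ℝ, 0 < c ∧ ∀ v w, v ≠ w → ∃ (r : ℕ) (D : Finset ℤ),
        D.card ≤ 2 * r + 1 ∧ (∀ z ∈ D, lampAt v z ≠ lampAt w z) ∧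
        wordDist (canonicalGens S intGens) v w ≤
          7 * (r + ∑ z ∈ D, wordDist S (lampAt v z) (lampAt w z)) ∧
        (r : ℝ) ^ (2 * θ) / 2 ≤ ‖Φ v - Φ w‖ ^ 2 ∧
        c * ∑ z ∈ D, (wordDist S (lampAt v z) (lampAt w z) : ℝ) ^ (2 * α) ≤ ‖Φ v - Φ w‖ ^ 2 := by
  obtain ⟨φ, ⟨L, hL⟩, c, hc, hφ⟩ := h
  obtain ⟨F₀, hF₀L, hF₀⟩ := exists_cursor_map hS
  obtain ⟨F₁, hF₁L, hF₁⟩ := exists_lamps_map hS hL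
  obtain ⟨F₂, hF₂L, hF₂⟩ := exists_tree_map hS (a := θ - 1 / 2) (by linarith) (by linarith)
    (ε := 1) (Or.inl rfl)
  obtain ⟨F₃, hF₃L, hF₃⟩ := exists_tree_map hS (a := θ - 1 / 2) (by linarith) (by linarith)
    (ε := -1) (Or.inr rfl)
  have hexp : 2 * (θ - 1 / 2) + 1 = 2 * θ := by ring
  rw [hexp] at hF₂ hF₃
  obtain ⟨Φ, hΦL, hΦ⟩ := (isFiniteSymmGen_wreath hS).exists_map_dominating ![F₀, F₁, F₂, F₃]
    (by intro i; fin_cases i <;> assumption)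
  refine ⟨Φ, hΦL, c ^ 2, by positivity, fun v w hvw => ?_⟩
  set D := (finite_lampAt_ne v w).toFinset with hDdef
  have hD : ∀ z, z ∈ D ↔ lampAt v z ≠ lampAt w z := fun z => by simp [hDdef]
  set r := max (cursor w - cursor v).natAbs (D.sup fun z => (z - cursor v).natAbs) with hr
  have hrD : ∀ z ∈ D, (z - cursor v).natAbs ≤ r := fun z hz =>
    (Finset.le_sup (f := fun z => (z - cursor v).natAbs) hz).trans (le_max_right _ _)
  refine ⟨r, D, ?_, fun z hz => (hD z).1 hz,
    wordDist_wreath_le hS r (le_max_left _ _) D hD hrD hvw, ?_, ?_⟩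
  · have hsub : D ⊆ Finset.Icc (cursor v - r) (cursor v + r) := by
      intro z hz
      have := hrD z hz
      rw [Finset.mem_Icc]
      omega
    refine (Finset.card_le_card hsub).trans (le_of_eq ?_)
    rw [Int.card_Icc]
    omega
  · rcases Nat.eq_zero_or_pos r with h0 | hpos
    · rw [h0, Nat.cast_zero, Real.zero_rpow (by linarith)]
      simp
    -- The extent is attained by the cursor, or by a differing lamp to the right or left of the
    -- starting point; each case has its own map.
    rcases max_choice (cursor w - cursor v).natAbs (D.sup fun z => (z - cursor v).natAbs)
      with hmax | hmax
    · rw [← hr] at hmax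
      have h1 := (hF₀ v w).trans (hΦ 0 v w)
      rw [← hmax] at h1
      have h2 : (r : ℝ) ^ (2 * θ) ≤ (r : ℝ) ^ 2 := by
        rw [← Real.rpow_natCast]
        exact Real.rpow_le_rpow_of_exponent_le (by exact_mod_cast hpos) (by push_cast; linarith)
      have h3 : 0 ≤ (r : ℝ) ^ (2 * θ) := by positivity
      linarith
    · rw [← hr] at hmax
      have hne : D.Nonempty := by
        rw [Finset.nonempty_iff_ne_empty]
        intro he
        rw [he, Finset.sup_empty] at hmax
        exact hpos.ne' hmax
      obtain ⟨z, hz, hsup⟩ := Finset.exists_mem_eq_sup D hne fun z => (z - cursor v).natAbs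
      rw [← hmax] at hsup
      rcases Int.natAbs_eq (z - cursor v) with h | h
      · exact (hF₂ v w z ((hD z).1 hz) r (by omega)).trans (hΦ 2 v w)
      · exact (hF₃ v w z ((hD z).1 hz) r (by omega)).trans (hΦ 3 v w)
  · refine le_trans ?_ ((hF₁ v w D).trans (hΦ 1 v w))
    rw [Finset.mul_sum]
    refine Finset.sum_le_sum fun z hz => ?_
    have h1 := hφ _ _ ((hD z).1 hz)
    have h2 : c ^ 2 * (wordDist S (lampAt v z) (lampAt w z) : ℝ) ^ (2 * α) =
        (c * (wordDist S (lampAt v z) (lampAt w z) : ℝ) ^ α) ^ 2 := by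
      rw [mul_pow, ← Real.rpow_natCast (_ ^ α), ← Real.rpow_mul (Nat.cast_nonneg _)]
      congr 2
      push_cast
      ring
    rw [h2]
    exact pow_le_pow_left₀ (by positivity) h1 2

end Embedding

end Compression

namespace Compression

/-! ### Comparing exponents -/

section Exponents

/-- Factor the left side as `∑ f i * (∑ f) ^ (p - 1)`; since `p - 1 ≤ 0`, replacing the total by the
smaller `f i` only increases each term. -/
theorem rpow_sum_le_sum_rpow_of_le_one {ι : Type*} (D : Finset ι) {f : ι → ℝ}
    (hf : ∀ i ∈ D, 0 < f i) {p : ℝ} (hp0 : 0 < p) (hp1 : p ≤ 1) :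
    (∑ i ∈ D, f i) ^ p ≤ ∑ i ∈ D, f i ^ p := by
  rcases D.eq_empty_or_nonempty with rfl | hne
  · simp [Real.zero_rpow hp0.ne']
  have hpos : 0 < ∑ i ∈ D, f i := Finset.sum_pos hf hne
  calc (∑ i ∈ D, f i) ^ p = ∑ i ∈ D, f i * (∑ i ∈ D, f i) ^ (p - 1) := by
        rw [← Finset.sum_mul, Real.rpow_sub_one hpos.ne']
        field_simp
    _ ≤ ∑ i ∈ D, f i ^ p := by
        refine Finset.sum_le_sum fun i hi => ?_
        have h1 : f i ^ p = f i * f i ^ (p - 1) := by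
          rw [Real.rpow_sub_one (hf i hi).ne']
          field_simp [(hf i hi).ne']
        rw [h1]
        exact mul_le_mul_of_nonneg_left (Real.rpow_le_rpow_of_nonpos (hf i hi)
          (Finset.single_le_sum (fun j hj => (hf j hj).le) hi) (by linarith)) (hf i hi).le

/-- The lower bound when the energy of the lamps is subadditive. -/
theorem exists_lower_bound_of_le_half {α c : ℝ} (hα0 : 0 < α) (hα : α ≤ 1 / 2) (hc : 0 < c) :
    ∃ c' : ℝ, 0 < c' ∧ ∀ d r σ E N : ℝ, 1 ≤ d → d ≤ 7 * (r + σ) →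
      σ ^ (2 * α) ≤ E → r / 2 ≤ N → c * E ≤ N → c' * d ^ (2 * α) ≤ N := by
  -- From `d ≤ 7 * (r + σ)`, one of `r`, `σ` is at least `d / 14`; the bound `r / 2 ≤ N` turns the
  -- first case into `1/28`.
  refine ⟨min (1 / 28) (c * (1 / 14) ^ (2 * α)), by positivity,
    fun d r σ E N hd hdr hE hr hN => ?_⟩
  have hdpos : 0 ≤ d ^ (2 * α) := by positivity
  by_cases h : d / 14 ≤ r
  · have h1 : d ^ (2 * α) ≤ d := by
      simpa using Real.rpow_le_rpow_of_exponent_le hd (by linarith : 2 * α ≤ 1)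
    have h2 := mul_le_mul_of_nonneg_right (min_le_left (1 / 28) (c * (1 / 14 : ℝ) ^ (2 * α))) hdpos
    linarith
  · have hσ : d * (1 / 14) ≤ σ := by linarith
    have h1 : d ^ (2 * α) * (1 / 14) ^ (2 * α) ≤ E := by
      rw [← Real.mul_rpow (by linarith) (by norm_num)]
      exact le_trans (Real.rpow_le_rpow (by linarith) hσ (by linarith)) hE
    have h2 := mul_le_mul_of_nonneg_right (min_le_right (1 / 28) (c * (1 / 14 : ℝ) ^ (2 * α))) hdpos
    have h3 := mul_le_mul_of_nonneg_left h1 hc.le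
    linarith

/-- The lower bound from the power mean inequality over at most `2 * r + 1` lamps. -/
theorem exists_lower_bound_of_half_le {α β θ c : ℝ} (hα : 1 / 2 ≤ α) (hβ : 0 < β) (hβθ : β ≤ θ)
    (hexp : 2 * β + (2 * α - 1) * (β / θ) ≤ 2 * α) (hc : 0 < c) :
    ∃ c' : ℝ, 0 < c' ∧ ∀ d r σ E k N : ℝ, 1 ≤ d → d ≤ 7 * (r + σ) → 0 ≤ E → 0 ≤ k →
      k ≤ 2 * r + 1 → σ ^ (2 * α) ≤ k ^ (2 * α - 1) * E → r ^ (2 * θ) / 2 ≤ N → c * E ≤ N →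
        c' * d ^ (2 * β) ≤ N := by
  have hθ : 0 < θ := hβ.trans_le hβθ
  set c₁ : ℝ := (1 / 14) ^ (2 * θ) / 2 with hc₁
  set c₂ : ℝ := c * ((1 / 14) ^ (2 * α) / 3 ^ (2 * α - 1)) with hc₂
  refine ⟨min c₁ (min (1 / 2) c₂), by positivity, fun d r σ E k N hd hdr hE hk0 hk hσE hr hN => ?_⟩
  have hd0 : 0 < d := by linarith
  have hdpos : 0 ≤ d ^ (2 * β) := by positivity
  by_cases h : d / 14 ≤ r
  · have h1 : d ^ (2 * β) ≤ d ^ (2 * θ) :=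
      Real.rpow_le_rpow_of_exponent_le hd (by linarith)
    have h2 : d ^ (2 * θ) * (1 / 14) ^ (2 * θ) ≤ r ^ (2 * θ) := by
      rw [← Real.mul_rpow hd0.le (by norm_num)]
      exact Real.rpow_le_rpow (by positivity) (by linarith) (by linarith)
    calc min c₁ (min (1 / 2) c₂) * d ^ (2 * β) ≤ c₁ * d ^ (2 * θ) := by
          gcongr
          exact min_le_left _ _
      _ ≤ N := by rw [hc₁]; linarith
  have hσ : d * (1 / 14) ≤ σ := by linarith
  -- Above this threshold `r ^ (2θ) ≥ d ^ (2β)` and the trees suffice. Below it `k ≤ 2r + 1 ≤ 3 * d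
  -- ^ (β / θ)`, and `hexp` says that the power mean loss still leaves `d ^ (2β)`.
  by_cases h' : d ^ (β / θ) ≤ r
  · have h1 : d ^ (2 * β) ≤ r ^ (2 * θ) := by
      have : d ^ (2 * β) = (d ^ (β / θ)) ^ (2 * θ) := by
        rw [← Real.rpow_mul hd0.le]
        congr 1
        field_simp
      rw [this]
      exact Real.rpow_le_rpow (by positivity) h' (by linarith)
    calc min c₁ (min (1 / 2) c₂) * d ^ (2 * β) ≤ 1 / 2 * r ^ (2 * θ) := by
          gcongr
          exact (min_le_right _ _).trans (min_le_left _ _)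
      _ ≤ N := by linarith
  have hone : 1 ≤ d ^ (β / θ) := Real.one_le_rpow hd (by positivity)
  have hk3 : k ^ (2 * α - 1) ≤ 3 ^ (2 * α - 1) * d ^ ((2 * α - 1) * (β / θ)) := by
    rw [mul_comm (2 * α - 1) (β / θ), Real.rpow_mul hd0.le,
      ← Real.mul_rpow (by norm_num) (by positivity)]
    exact Real.rpow_le_rpow hk0 (by linarith) (by linarith)
  have h1 : d ^ (2 * α) * (1 / 14) ^ (2 * α) ≤
      3 ^ (2 * α - 1) * d ^ ((2 * α - 1) * (β / θ)) * E := by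
    rw [← Real.mul_rpow hd0.le (by norm_num)]
    refine (Real.rpow_le_rpow (by positivity) hσ (by linarith)).trans (hσE.trans ?_)
    gcongr
  have h2 : d ^ (2 * β) * d ^ ((2 * α - 1) * (β / θ)) ≤ d ^ (2 * α) := by
    rw [← Real.rpow_add hd0]
    exact Real.rpow_le_rpow_of_exponent_le hd hexp
  have h3 : (1 / 14 : ℝ) ^ (2 * α) / 3 ^ (2 * α - 1) * d ^ (2 * β) ≤ E := by
    have hpos : 0 < d ^ ((2 * α - 1) * (β / θ)) := by positivity
    rw [div_mul_eq_mul_div, div_le_iff₀ (by positivity)]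
    refine le_of_mul_le_mul_right ?_ hpos
    calc _ = d ^ (2 * β) * d ^ ((2 * α - 1) * (β / θ)) * (1 / 14) ^ (2 * α) := by ring
      _ ≤ d ^ (2 * α) * (1 / 14) ^ (2 * α) := by gcongr
      _ ≤ _ := h1
      _ = _ := by ring
  calc min c₁ (min (1 / 2) c₂) * d ^ (2 * β) ≤ c₂ * d ^ (2 * β) := by
        gcongr
        exact (min_le_right _ _).trans (min_le_right _ _)
    _ = c * ((1 / 14 : ℝ) ^ (2 * α) / 3 ^ (2 * α - 1) * d ^ (2 * β)) := by rw [hc₂]; ring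
    _ ≤ c * E := by gcongr
    _ ≤ N := hN

theorem hasCompression_of_sq {G X : Type*} [Group G] {S : Set G} [NormedAddCommGroup X] {Φ : G → X}
    {β c : ℝ} (hL : ∃ L : ℝ, ∀ x y, ‖Φ x - Φ y‖ ≤ L * wordDist S x y) (hc : 0 < c)
    (h : ∀ x y, x ≠ y → c * (wordDist S x y : ℝ) ^ (2 * β) ≤ ‖Φ x - Φ y‖ ^ 2) :
    HasCompression S X β := by
  refine ⟨Φ, hL, √c, by positivity, fun x y hxy => ?_⟩
  refine le_of_sq_le_sq ?_ (norm_nonneg _)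
  refine le_trans (le_of_eq ?_) (h x y hxy)
  rw [mul_pow, Real.sq_sqrt hc.le, ← Real.rpow_natCast, ← Real.rpow_mul (Nat.cast_nonneg _)]
  push_cast
  rw [mul_comm β]

variable {G : Type*} [Group G] {S : Set G}

theorem hasCompression_wreath_of_le_half (hS : IsFiniteSymmGen S) {α : ℝ} (hα0 : 0 < α)
    (hα : α ≤ 1 / 2) (h : HasCompression S L2 α) :
    HasCompression (canonicalGens S intGens : Set (wreath G (Multiplicative ℤ))) L2 α := by
  have hC := isFiniteSymmGen_wreath hS
  -- With `θ = 1/2` the squared norm is already linear in `r`, enough since `2α ≤ 1`.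
  obtain ⟨Φ, hL, c, hc, hΦ⟩ := exists_wreath_map hS h le_rfl (by norm_num)
  obtain ⟨c', hc', hlow⟩ := exists_lower_bound_of_le_half hα0 hα hc
  refine hasCompression_of_sq hL hc' fun v w hvw => ?_
  obtain ⟨r, D, -, hD, hd, hr, hE⟩ := hΦ v w hvw
  have hd' : (wordDist (canonicalGens S intGens) v w : ℝ) ≤
      7 * (r + ∑ z ∈ D, (wordDist S (lampAt v z) (lampAt w z) : ℝ)) := by exact_mod_cast hd
  rw [show 2 * (1 / 2 : ℝ) = 1 by norm_num, Real.rpow_one] at hr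
  refine hlow _ r _ _ _ (by exact_mod_cast hC.one_le_wordDist hvw) hd' ?_ hr hE
  exact rpow_sum_le_sum_rpow_of_le_one D
    (fun z hz => by exact_mod_cast hS.one_le_wordDist (hD z hz)) (by linarith) (by linarith)

theorem hasCompression_wreath_of_half_lt (hS : IsFiniteSymmGen S) {α β : ℝ} (hα : 1 / 2 < α)
    (hβ : 0 < β) (hβα : β * (2 * α + 1) < 2 * α) (h : HasCompression S L2 α) :
    HasCompression (canonicalGens S intGens : Set (wreath G (Multiplicative ℤ))) L2 β := by
  have hC := isFiniteSymmGen_wreath hS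
  have hlt : 0 < 2 * α - 2 * β := by nlinarith
  have hβ1 : β < 1 := by nlinarith
  -- The last lower bound on `θ` is `hexp` solved for `θ`; it is less than `1` precisely when `β *
  -- (2 * α + 1) < 2 * α`.
  obtain ⟨θ, hθ, hθ1, hβθ, hθβ⟩ : ∃ θ : ℝ, 1 / 2 ≤ θ ∧ θ < 1 ∧ β ≤ θ ∧
      β * (2 * α - 1) / (2 * α - 2 * β) ≤ θ := by
    refine ⟨max (1 / 2) (max β (β * (2 * α - 1) / (2 * α - 2 * β))), le_max_left _ _,
      max_lt (by norm_num) (max_lt hβ1 ?_), (le_max_left _ _).trans (le_max_right _ _),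
      (le_max_right _ _).trans (le_max_right _ _)⟩
    rw [div_lt_one hlt]
    linarith
  have hexp : 2 * β + (2 * α - 1) * (β / θ) ≤ 2 * α := by
    have hθ0 : 0 < θ := by linarith
    rw [div_le_iff₀ hlt] at hθβ
    have : (2 * α - 1) * (β / θ) ≤ 2 * α - 2 * β := by
      rw [← mul_div_assoc, div_le_iff₀ hθ0]
      linarith
    linarith
  obtain ⟨Φ, hL, c, hc, hΦ⟩ := exists_wreath_map hS h hθ hθ1
  obtain ⟨c', hc', hlow⟩ := exists_lower_bound_of_half_le hα.le hβ hβθ hexp hc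
  refine hasCompression_of_sq hL hc' fun v w hvw => ?_
  obtain ⟨r, D, hcard, -, hd, hr, hE⟩ := hΦ v w hvw
  have hd' : (wordDist (canonicalGens S intGens) v w : ℝ) ≤
      7 * (r + ∑ z ∈ D, (wordDist S (lampAt v z) (lampAt w z) : ℝ)) := by exact_mod_cast hd
  refine hlow _ r _ _ D.card _ (by exact_mod_cast hC.one_le_wordDist hvw) hd'
    (Finset.sum_nonneg fun z _ => by positivity) (Nat.cast_nonneg _) (by exact_mod_cast hcard)
    ?_ hr hE
  exact Real.rpow_sum_le_const_mul_sum_rpow_of_nonneg D (by linarith)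
    fun z _ => Nat.cast_nonneg _

/-- Exponents below both `1 / 2` and the exponent of `G` are admissible for `G ≀ ℤ`. -/
theorem le_hilbertCompressionExponent_wreath [Infinite G] (hS : IsFiniteSymmGen S) {β : ℝ}
    (hβ : β ≤ 1 / 2) (h : β < hilbertCompressionExponent S) :
    β ≤ hilbertCompressionExponent
      (canonicalGens S intGens : Set (wreath G (Multiplicative ℤ))) := by
  rcases le_or_gt β 0 with h0 | h0
  · exact h0.trans (compressionExponent_nonneg _ _)
  obtain ⟨α, hα, hα'⟩ := exists_hasCompression_of_lt h0.le h
  exact (isFiniteSymmGen_wreath hS).le_compressionExponent h0.le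
    (hasCompression_wreath_of_le_half hS h0 hβ (hα'.mono hS hα.le))

end Exponents

end Compression

/-- `S` and `T` are arbitrary finite symmetric generating sets of `G` and of the wreath product of
`G` and `ℤ`, used to define the two word metrics. -/
theorem theorem1p2 {G : Type*} [Group G] [Infinite G] (S : Set G)
    (hS : Compression.IsFiniteSymmGen S)
    (T : Set (Compression.wreath G (Multiplicative ℤ))) (hT : Compression.IsFiniteSymmGen T) :
    ((1 / 2 : ℝ) ≤ Compression.hilbertCompressionExponent S →
      2 * Compression.hilbertCompressionExponent S /
          (2 * Compression.hilbertCompressionExponent S + 1) ≤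
        Compression.hilbertCompressionExponent T) ∧
    (Compression.hilbertCompressionExponent S ≤ (1 / 2 : ℝ) →
      Compression.hilbertCompressionExponent T = Compression.hilbertCompressionExponent S) := by
  have hC := Compression.isFiniteSymmGen_wreath hS
  have hTC : Compression.hilbertCompressionExponent T = Compression.hilbertCompressionExponent
      (Compression.canonicalGens S Compression.intGens) := Compression.compressionExponent_congr hT hC
  rw [hTC]
  set a := Compression.hilbertCompressionExponent S with ha
  refine ⟨fun h => le_of_forall_lt_imp_le_of_dense fun β hβ => ?_, fun h => le_antisymm
    (Compression.compressionExponent_wreath_le hS _) (le_of_forall_lt_imp_le_of_dense fun β hβ =>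
      Compression.le_hilbertCompressionExponent_wreath hS (hβ.le.trans h) hβ)⟩
  rcases h.eq_or_lt with h | h
  -- At `a = 1/2` the target is `1/2` itself, so the subadditive case already covers every `β` below
  -- it.
  · rw [← h] at hβ
    norm_num at hβ
    exact Compression.le_hilbertCompressionExponent_wreath hS hβ.le (by rw [← ha, ← h]; exact hβ)
  · rcases le_or_gt β 0 with h0 | h0
    · exact h0.trans (Compression.compressionExponent_nonneg _ _)
    rw [lt_div_iff₀ (by linarith)] at hβ
    have hβ1 : 0 < 2 * (1 - β) := by nlinarith
    -- Solving `β * (2 * α + 1) < 2 * α` for `α` gives `α > β / (2 * (1 - β))`.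
    have hlt : max (1 / 2) (β / (2 * (1 - β))) < a := by
      refine max_lt h ?_
      rw [div_lt_iff₀ hβ1]
      linarith
    obtain ⟨α, hα, hcomp⟩ := Compression.exists_hasCompression_of_lt (by positivity) hlt
    obtain ⟨h1, h2⟩ := max_lt_iff.1 hα
    rw [div_lt_iff₀ hβ1] at h2
    exact hC.le_compressionExponent h0.le
      (Compression.hasCompression_wreath_of_half_lt hS h1 h0 (by linarith) hcomp)
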